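/- Let $k\ge 1$. Partitions are allowed to be empty; $l(\lambda)$ denotes the number of parts, $|\lambda|$ the sum of the parts and $\max\lambda$ the largest part of $\lambda$ (with $\max\emptyset=0$). A *$k$-marked Durfee symbol* of an integer $n\ge 0$ consists of an integer $D\ge 0$ and partitions $\alpha^1,\dots,\alpha^k,\beta^1,\dots,\beta^k$ with $\sum_{i=1}^k(|\alpha^i|+|\beta^i|)+D^2=n$ such that 1. $\alpha^i\neq\emptyset$ for $1\le i<k$; 2. for $2\le i\le k$, $\max\beta^{i-1}\le\max\alpha^{i-1}$, and $\max\alpha^{i-1}$ is at most every part of $\alpha^i$ and at most every part of $\beta^i$; 3. all parts of all $\alpha^i$ and $\beta^i$ are at most $D$. Its $i$-th rank is $l(\alpha^i)-l(\beta^i)-1$ for $1\le i<k$, and $l(\alpha^k)-l(\beta^k)$ for $i=k$. Let $\mathcal D_k(m_1,\dots,m_k;n)$ be the (finite) number of $k$-marked Durfee symbols of $n$ whose $i$-th rank is $m_i$ for every $i$, and put $$R_k(x_1,\dots,x_k;q)=\sum_{m_1,\dots,m_k=-\infty}^{\infty}\ \sum_{n=0}^{\infty}\mathcal D_k(m_1,\dots,m_k;n)\,x_1^{m_1}\cdots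 x_k^{m_k}q^n,\qquad (q;q)_\infty=\prod_{j\ge1}(1-q^j).$$ **Theorem (Andrews).** Let $q,x_1,\dots,x_k$ be complex numbers with $|q|<1$ and $|q|<|x_j|$, $|q|\,|x_j|<1$ for $j=1,\dots,k$. Then the series defining $R_k(x_1,\dots,x_k;q)$ and the series over $n$ below converge absolutely, and $$R_k(x_1,\dots,x_k;q)=\delta_{k,1}+\frac{1}{(q;q)_\infty}\sum_{n=1}^{\infty}(-1)^{n-1}q^{3n(n-1)/2+kn}\,\frac{(1+q^n)(1-q^n)^2}{\prod_{j=1}^k(1-x_jq^n)\left(1-\frac{q^n}{x_j}\right)},$$ where $\delta_{k,1}$ is $1$ if $k=1$ and $0$ otherwise. (The term $\delta_{k,1}$ is the contribution of the empty symbol of $n=0$, which exists only for $k=1$; if only symbols of positive integers are counted, the identity holds for all $k\ge1$ without it.) -/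

import Mathlib

open scoped BigOperators

/-- A `k`-marked Durfee symbol. A partition (possibly empty) is the multiset of its parts, all of
which are positive; its length is the cardinality of the multiset and its largest part is
`Multiset.sup` (equal to `0` for the empty partition). The index `i : Fin k` stands for the
`(i+1)`-st vector `(α^{i+1}, β^{i+1})`, so `i + 1 < k` means "not the last vector".

The entries of either row weakly decrease from the `k`-th vector down to the first one, and the
nonempty partition `α^{i-1}` bounds the `i`-th vector from below by its largest part. -/
@[ext]
structure MarkedDurfeeSymbol (k : ℕ) where
  /-- the subscript -/
  D : ℕ
  /-- the top partitions -/
  α : Fin k → Multiset ℕ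
  /-- the bottom partitions -/
  β : Fin k → Multiset ℕ
  α_pos : ∀ i, ∀ a ∈ α i, 0 < a
  β_pos : ∀ i, ∀ b ∈ β i, 0 < b
  /-- the top partitions, except possibly the last, are nonempty -/
  α_nonempty : ∀ i : Fin k, (i : ℕ) + 1 < k → α i ≠ 0
  /-- in each vector but the last, the largest part of the top partition is at least the
  largest part of the bottom partition -/
  β_sup_le : ∀ i : Fin k, (i : ℕ) + 1 < k → (β i).sup ≤ (α i).sup
  /-- the largest part of a top partition is at most every part of the next vector -/
  sup_le_α : ∀ i j : Fin k, (i : ℕ) + 1 = j → ∀ a ∈ α j, (α i).sup ≤ a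
  sup_le_β : ∀ i j : Fin k, (i : ℕ) + 1 = j → ∀ b ∈ β j, (α i).sup ≤ b
  /-- no part exceeds the subscript -/
  α_le : ∀ i, ∀ a ∈ α i, a ≤ D
  β_le : ∀ i, ∀ b ∈ β i, b ≤ D

namespace MarkedDurfeeSymbol

/-- The number of which `η` is a symbol: the sum of all parts plus the square of the subscript. -/
def weight {k : ℕ} (η : MarkedDurfeeSymbol k) : ℕ :=
  ∑ i, ((η.α i).sum + (η.β i).sum) + η.D ^ 2

/-- The `i`-th rank: the difference of the lengths of the `i`-th top and bottom partitions,
diminished by `1` unless the `i`-th vector is the last one. -/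
def rank {k : ℕ} (η : MarkedDurfeeSymbol k) (i : Fin k) : ℤ :=
  ((η.α i).card : ℤ) - ((η.β i).card : ℤ) - (if (i : ℕ) + 1 < k then 1 else 0)

/-- There are only finitely many `k`-marked Durfee symbols of a given number, so that counting
them with `Nat.card` is meaningful. -/
theorem finite_weight_eq (k n : ℕ) : {η : MarkedDurfeeSymbol k | η.weight = n}.Finite := by
  have key : ∀ s : Multiset ℕ, (∀ a ∈ s, 0 < a) → s.sum ≤ n →
      s ∈ Set.Iic (n • (Multiset.range (n + 1))) := by
    intro s hs hsum
    rw [Set.mem_Iic, Multiset.le_iff_count]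
    intro a
    rw [Multiset.count_nsmul]
    by_cases ha : a ∈ s
    · have h1 : a ≤ n := (Multiset.le_sum_of_mem ha).trans hsum
      have h2 : (Multiset.range (n + 1)).count a = 1 :=
        Multiset.count_eq_one_of_mem (Multiset.nodup_range _) (by simpa using by omega)
      have h3 : s.card ≤ s.sum := by
        simpa using Multiset.card_nsmul_le_sum (s := s) (a := 1) (fun x hx => hs x hx)
      rw [h2, mul_one]
      exact (Multiset.count_le_card a s).trans (h3.trans hsum)
    · rw [Multiset.count_eq_zero_of_notMem ha]
      exact Nat.zero_le _
  have hfin : (Set.Iic (n • (Multiset.range (n + 1)))).Finite := Set.finite_Iic _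
  have hpi : (Set.univ.pi fun _ : Fin k => Set.Iic (n • (Multiset.range (n + 1)))).Finite :=
    Set.Finite.pi fun _ => hfin
  refine Set.Finite.of_finite_image (f := fun η => (η.D, η.α, η.β))
    (((Set.finite_Iic n).prod (hpi.prod hpi)).subset ?_) ?_
  · rintro _ ⟨η, hη, rfl⟩
    have hη' : ∑ i, ((η.α i).sum + (η.β i).sum) + η.D ^ 2 = n := hη
    have hle : ∀ i, (η.α i).sum + (η.β i).sum ≤ n := fun i =>
      (Finset.single_le_sum (f := fun i => (η.α i).sum + (η.β i).sum)
        (fun _ _ => Nat.zero_le _) (Finset.mem_univ i)).trans (by omega)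
    refine ⟨?_, ?_, ?_⟩
    · have := Nat.le_self_pow two_ne_zero η.D
      simp only [Set.mem_Iic]
      omega
    · intro i _
      exact key (η.α i) (η.α_pos i) (by have := hle i; omega)
    · intro i _
      exact key (η.β i) (η.β_pos i) (by have := hle i; omega)
  · intro η _ η' _ h
    simp only [Prod.mk.injEq] at h
    exact MarkedDurfeeSymbol.ext h.1 h.2.1 h.2.2

end MarkedDurfeeSymbol

/-- `𝒟_k(m_1, …, m_k; n)`: the number of `k`-marked Durfee symbols of `n` whose `i`-th rank is
`m_i` for every `i`. -/
noncomputable def markedDurfeeCount (k : ℕ) (m : Fin k → ℤ) (n : ℕ) : ℕ :=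
  Nat.card {η : MarkedDurfeeSymbol k // η.weight = n ∧ ∀ i, η.rank i = m i}

/-- The term `𝒟_k(m_1, …, m_k; n) x_1^{m_1} ⋯ x_k^{m_k} q^n` of the rank generating function. -/
noncomputable def rankTerm (k : ℕ) (x : Fin k → ℂ) (q : ℂ) (p : (Fin k → ℤ) × ℕ) : ℂ :=
  (markedDurfeeCount k p.1 p.2 : ℂ) * (∏ i, x i ^ p.1 i) * q ^ p.2

/-- The generating function `R_k(x_1, …, x_k; q)` for `k`-marked Durfee symbols by ranks. -/
noncomputable def rankGenFun (k : ℕ) (x : Fin k → ℂ) (q : ℂ) : ℂ :=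
  ∑' p : (Fin k → ℤ) × ℕ, rankTerm k x q p

/-- The infinite product `(a; q)_∞ = ∏_{j ≥ 0} (1 - a q^j)`. -/
noncomputable def qPochInf (a q : ℂ) : ℂ :=
  ∏' j : ℕ, (1 - a * q ^ j)

/-- The product that defines `(a; q)_∞` converges for `|q| < 1`. -/
theorem multipliable_qPochInf (a q : ℂ) (hq : ‖q‖ < 1) :
    Multipliable fun j : ℕ => 1 - a * q ^ j := by
  have h : Summable fun j : ℕ => ‖-(a * q ^ j)‖ := by
    simpa [norm_mul, norm_pow] using
      (summable_geometric_of_lt_one (norm_nonneg q) hq).mul_left ‖a‖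
  simpa [sub_eq_add_neg] using multipliable_one_add_of_summable h

/-- The `n`-th term of the series on the right-hand side, meant for `n ≥ 1`. -/
noncomputable def andrewsTerm (k : ℕ) (x : Fin k → ℂ) (q : ℂ) (n : ℕ) : ℂ :=
  (-1) ^ (n - 1) * q ^ (3 * n * (n - 1) / 2 + k * n) * ((1 + q ^ n) * (1 - q ^ n) ^ 2) /
    ∏ j, ((1 - x j * q ^ n) * (1 - q ^ n / x j))

open Filter Topology

/-! Fix the subscript `D = L ≥ 1` and drop the factor `q^(L²)`. The symbols then have generating
function `baileySum k x q L`, the `β_L` of a Bailey pair relative to `a = 1`, because both sides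
obey the same recursion in `k`.

Combinatorially, let `r` be the largest part of the last but one top partition. Delete the last
vector and one copy of `r`: what remains is a symbol with one vector fewer and subscript `r`, and
the deleted vector is any pair of partitions with parts in `[r, L]` (`extend`, `mem_range_extend`).
The deleted copy of `r` contributes `q^r` and accounts for the `-1` in the rank.

Analytically, `bailey_step_identity` gives a first-order recursion in `L` for `β_L`. Solving it
yields the same sum over `r` (`baileySum_succ`); the case `k = 1` comes from the unit Bailey pair
(`baileySum_one`).

Finally, summing `q^(L²) β_L` over `L` is the limiting Bailey lemma (`hasSum_baileySum`), which
follows from the Durfee rectangle identity. The subscript `0` supplies the Kronecker delta. Absolute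
convergence follows from the same formulas at `‖q‖`, `‖x j‖`. -/

/-! ### The Bailey pair and its recursion in `L` -/

/-- The finite product `(q; q)_n = ∏_{j=1}^n (1 - q^j)`. -/
noncomputable def qFact (q : ℂ) (n : ℕ) : ℂ :=
  ∏ j ∈ Finset.range n, (1 - q ^ (j + 1))

/-- The kernel `1 / ((q; q)_{L-n} (q; q)_{L+n})` of a Bailey pair relative to `a = 1`; it vanishes
for `n > L`. -/
noncomputable def baileyKernel (q : ℂ) (L n : ℕ) : ℂ :=
  if n ≤ L then (qFact q (L - n) * qFact q (L + n))⁻¹ else 0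

/-- The first member `α_n` (for `n ≥ 1`) of the Bailey pair attached to `k`-marked Durfee symbols.
-/
noncomputable def baileyCoeff (k : ℕ) (x : Fin k → ℂ) (q : ℂ) (n : ℕ) : ℂ :=
  (-1) ^ (n - 1) * q ^ (n * (n - 1) / 2 + (k - 1) * n) * ((1 + q ^ n) * (1 - q ^ n) ^ 2) /
    ∏ j, ((1 - x j * q ^ n) * (1 - q ^ n / x j))

/-- The second member `β_L` of the Bailey pair attached to `k`-marked Durfee symbols. -/
noncomputable def baileySum (k : ℕ) (x : Fin k → ℂ) (q : ℂ) (L : ℕ) : ℂ :=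
  ∑ n ∈ Finset.Icc 1 L, baileyCoeff k x q n * baileyKernel q L n

theorem qFact_zero (q : ℂ) : qFact q 0 = 1 := by
  simp [qFact]

theorem qFact_succ (q : ℂ) (n : ℕ) : qFact q (n + 1) = qFact q n * (1 - q ^ (n + 1)) := by
  simp [qFact, Finset.prod_range_succ]

theorem one_sub_ne_zero_of_norm_lt_one {z : ℂ} (hz : ‖z‖ < 1) : 1 - z ≠ 0 := by
  intro h
  rw [← sub_eq_zero.mp h] at hz
  simp at hz

theorem norm_mul_pow_lt_one {q y : ℂ} (hq : ‖q‖ < 1) (hy : ‖y‖ * ‖q‖ < 1) {n : ℕ} (hn : 1 ≤ n) :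
    ‖y * q ^ n‖ < 1 := by
  obtain ⟨m, rfl⟩ := Nat.exists_eq_add_of_le' hn
  rw [norm_mul, norm_pow, pow_succ, mul_left_comm]
  exact mul_lt_one_of_nonneg_of_lt_one_right (pow_le_one₀ (norm_nonneg _) hq.le)
    (by positivity) hy

theorem one_sub_pow_ne_zero {q : ℂ} (hq : ‖q‖ < 1) {n : ℕ} (hn : 1 ≤ n) : 1 - q ^ n ≠ 0 := by
  apply one_sub_ne_zero_of_norm_lt_one
  simpa using norm_mul_pow_lt_one (y := 1) hq (by simpa using hq) hn

theorem qFact_ne_zero {q : ℂ} (hq : ‖q‖ < 1) (n : ℕ) : qFact q n ≠ 0 :=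
  Finset.prod_ne_zero_iff.mpr fun _ _ => one_sub_pow_ne_zero hq (by omega)

theorem one_sub_mul_pow_ne_zero {q x : ℂ} (hq : ‖q‖ < 1) (hx : ‖q‖ < ‖x‖ ∧ ‖q‖ * ‖x‖ < 1)
    {n : ℕ} (hn : 1 ≤ n) : 1 - x * q ^ n ≠ 0 :=
  one_sub_ne_zero_of_norm_lt_one (norm_mul_pow_lt_one hq (by rw [mul_comm]; exact hx.2) hn)

theorem norm_inv_mul_lt_one {q x : ℂ} (hx : ‖q‖ < ‖x‖ ∧ ‖q‖ * ‖x‖ < 1) : ‖x⁻¹‖ * ‖q‖ < 1 := by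
  rw [norm_inv, inv_mul_lt_one₀ ((norm_nonneg q).trans_lt hx.1)]
  exact hx.1

theorem one_sub_pow_div_ne_zero {q x : ℂ} (hq : ‖q‖ < 1) (hx : ‖q‖ < ‖x‖ ∧ ‖q‖ * ‖x‖ < 1)
    {n : ℕ} (hn : 1 ≤ n) : 1 - q ^ n / x ≠ 0 := by
  rw [div_eq_inv_mul]
  exact one_sub_ne_zero_of_norm_lt_one (norm_mul_pow_lt_one hq (norm_inv_mul_lt_one hx) hn)

theorem ne_zero_of_norm_lt {q x : ℂ} (hx : ‖q‖ < ‖x‖ ∧ ‖q‖ * ‖x‖ < 1) : x ≠ 0 :=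
  norm_pos_iff.mp ((norm_nonneg q).trans_lt hx.1)

/-- Each of the two `q`-factorials loses its top factor. At `n = M + 1` both sides vanish, so sums
for `M` and `M + 1` can share one range. -/
theorem baileyKernel_of_succ {q : ℂ} (hq : ‖q‖ < 1) {M n : ℕ} (hn : n ≤ M + 1) :
    baileyKernel q M n =
      (1 - q ^ (M + 1 - n)) * (1 - q ^ (M + 1 + n)) * baileyKernel q (M + 1) n := by
  rcases Nat.lt_or_ge M n with h | h
  · obtain rfl : n = M + 1 := by omega
    simp [baileyKernel]
  · obtain ⟨d, rfl⟩ := Nat.exists_eq_add_of_le h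
    have h1 : n + d + 1 - n = d + 1 := by omega
    have h2 : n + d - n = d := by omega
    have h3 : n + d + 1 + n = n + d + n + 1 := by omega
    have := qFact_ne_zero hq d
    have := qFact_ne_zero hq (n + d + n)
    have := one_sub_pow_ne_zero hq (n := d + 1) (by omega)
    have := one_sub_pow_ne_zero hq (n := n + d + n + 1) (by omega)
    rw [baileyKernel, baileyKernel, if_pos h, if_pos hn, h1, h2, h3, qFact_succ, qFact_succ]
    field_simp

/-- Both products on the left expand with the same terms `1 + q^(2L)`; the cross terms that survive
share the factor `q^(L-n)`. -/
theorem bailey_step_identity {q x : ℂ} (hx : x ≠ 0) {L n : ℕ} (hn : n ≤ L) :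
    (1 - x * q ^ L) * (1 - q ^ L / x) - (1 - q ^ (L - n)) * (1 - q ^ (L + n)) =
      q ^ (L - n) * ((1 - x * q ^ n) * (1 - q ^ n / x)) := by
  obtain ⟨d, rfl⟩ := Nat.exists_eq_add_of_le hn
  rw [Nat.add_sub_cancel_left]
  field_simp
  ring

/-- The effect on the coefficients is multiplication by `(1 - x q^n)(1 - q^n / x)`, exactly what
cancels one denominator factor of `baileyCoeff`. -/
theorem bailey_step_sum {q x : ℂ} (hq : ‖q‖ < 1) (hx : x ≠ 0) (a : ℕ → ℂ) (M : ℕ) :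
    (1 - x * q ^ (M + 1)) * (1 - q ^ (M + 1) / x) *
        ∑ n ∈ Finset.Icc 1 (M + 1), a n * baileyKernel q (M + 1) n -
      ∑ n ∈ Finset.Icc 1 M, a n * baileyKernel q M n =
    ∑ n ∈ Finset.Icc 1 (M + 1), q ^ (M + 1 - n) * ((1 - x * q ^ n) * (1 - q ^ n / x)) * a n *
      baileyKernel q (M + 1) n := by
  have h : ∑ n ∈ Finset.Icc 1 M, a n * baileyKernel q M n =
      ∑ n ∈ Finset.Icc 1 (M + 1), a n * baileyKernel q M n := by
    rw [Finset.sum_Icc_succ_top (by omega)]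
    simp [baileyKernel]
  rw [h, Finset.mul_sum, ← Finset.sum_sub_distrib]
  refine Finset.sum_congr rfl fun n hn => ?_
  have hn' := (Finset.mem_Icc.mp hn).2
  rw [baileyKernel_of_succ hq hn', ← bailey_step_identity hx hn']
  ring

theorem triangle_succ (n : ℕ) : (n + 1) * (n + 1 - 1) / 2 = n * (n - 1) / 2 + n := by
  rw [← Finset.sum_range_id_mul_two, ← Finset.sum_range_id_mul_two,
    Finset.sum_range_succ]
  simp

/-- The unit Bailey pair relative to `a = 1`, with partial sums. -/
theorem unit_bailey_partial {q : ℂ} (hq : ‖q‖ < 1) (M N : ℕ) (hN : N ≤ M + 1) :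
    (1 - q ^ (M + 1)) * ∑ n ∈ Finset.Icc 1 N,
        (-1) ^ (n - 1) * q ^ (n * (n - 1) / 2) * (1 + q ^ n) * baileyKernel q (M + 1) n =
      (qFact q M * qFact q (M + 1))⁻¹ - (-1) ^ N * q ^ (N * (N - 1) / 2 + N) *
        (1 - q ^ (M + 1 - N)) * baileyKernel q (M + 1) N := by
  induction N with
  | zero =>
    have := qFact_ne_zero hq M
    have := one_sub_pow_ne_zero hq (n := M + 1) (by omega)
    simp only [baileyKernel]
    simp
    rw [qFact_succ]
    field_simp
    simp
  | succ N ih =>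
    -- Rewrites the old remainder with the kernel at `N + 1`, so that it telescopes against the new
    -- summand.
    have hk : baileyKernel q (M + 1) N * (1 - q ^ (M + 1 - N)) =
        (1 - q ^ (M + 1 + (N + 1))) * baileyKernel q (M + 1) (N + 1) := by
      obtain ⟨d, hd⟩ := Nat.exists_eq_add_of_le hN
      have h0 : N ≤ M + 1 := by omega
      have h1 : M + 1 - N = d + 1 := by omega
      have h2 : M + 1 - (N + 1) = d := by omega
      have h3 : M + 1 + (N + 1) = (M + 1 + N) + 1 := by omega
      have := qFact_ne_zero hq d
      have := qFact_ne_zero hq (M + 1 + N)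
      have := one_sub_pow_ne_zero hq (n := d + 1) (by omega)
      have := one_sub_pow_ne_zero hq (n := M + 1 + N + 1) (by omega)
      rw [baileyKernel, baileyKernel, if_pos hN, if_pos h0, h1, h2, h3, qFact_succ, qFact_succ]
      field_simp
    rw [Finset.sum_Icc_succ_top (by omega), mul_add, ih (by omega), triangle_succ]
    rw [mul_assoc _ (1 - q ^ (M + 1 - N)), mul_comm (1 - q ^ (M + 1 - N)), hk]
    obtain ⟨d, hd⟩ := Nat.exists_eq_add_of_le hN
    have h2 : M + 1 - (N + 1) = d := by omega
    rw [h2, hd, Nat.add_sub_cancel]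
    ring

/-- At `N = M + 1` the telescoping remainder contains `1 - q^0 = 0`. The right side is the `n = 0`
term of the unit pair, moved across. -/
theorem unit_bailey_sum {q : ℂ} (hq : ‖q‖ < 1) (M : ℕ) :
    ∑ n ∈ Finset.Icc 1 (M + 1),
        (-1) ^ (n - 1) * q ^ (n * (n - 1) / 2) * (1 + q ^ n) * baileyKernel q (M + 1) n =
      (qFact q (M + 1) ^ 2)⁻¹ := by
  have h := unit_bailey_partial hq M (M + 1) le_rfl
  have h1 := one_sub_pow_ne_zero hq (n := M + 1) (by omega)
  have h2 := qFact_ne_zero hq M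
  apply mul_left_cancel₀ h1
  rw [h, qFact_succ]
  simp
  field_simp

/-- This is the step at `x = 1` applied to the unit pair: `(1 - q^(M+1))² / (q;q)_{M+1}²` cancels `1
/ (q;q)_M²`. For `M = 0` the subtracted sum is empty, which leaves `1`. -/
theorem bailey_base_sum {q : ℂ} (hq : ‖q‖ < 1) (M : ℕ) :
    ∑ n ∈ Finset.Icc 1 (M + 1), q ^ (M + 1 - n) * ((-1) ^ (n - 1) * q ^ (n * (n - 1) / 2) *
        ((1 + q ^ n) * (1 - q ^ n) ^ 2)) * baileyKernel q (M + 1) n = if M = 0 then 1 else 0 := by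
  have h := bailey_step_sum hq one_ne_zero
    (fun n => (-1) ^ (n - 1) * q ^ (n * (n - 1) / 2) * (1 + q ^ n)) M
  rw [unit_bailey_sum hq] at h
  have h0 : ∑ n ∈ Finset.Icc 1 (M + 1), q ^ (M + 1 - n) * ((-1) ^ (n - 1) *
      q ^ (n * (n - 1) / 2) * ((1 + q ^ n) * (1 - q ^ n) ^ 2)) * baileyKernel q (M + 1) n =
      ∑ n ∈ Finset.Icc 1 (M + 1), q ^ (M + 1 - n) * ((1 - 1 * q ^ n) * (1 - q ^ n / 1)) *
        ((-1) ^ (n - 1) * q ^ (n * (n - 1) / 2) * (1 + q ^ n)) * baileyKernel q (M + 1) n :=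
    Finset.sum_congr rfl fun n _ => by ring
  rw [h0, ← h]
  have h1 := one_sub_pow_ne_zero hq (n := M + 1) (by omega)
  rcases M with _ | M
  · simp only [qFact_succ, qFact_zero] at *
    simp at *
    field_simp
  · have h2 := qFact_ne_zero hq (M + 1)
    rw [unit_bailey_sum hq, qFact_succ q (M + 1)]
    simp
    field_simp
    simp

theorem baileySum_zero (k : ℕ) (x : Fin k → ℂ) (q : ℂ) : baileySum k x q 0 = 0 := by
  simp [baileySum]

theorem baileySum_one_step {q : ℂ} (hq : ‖q‖ < 1) (x : Fin 1 → ℂ)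
    (hx : ∀ j, ‖q‖ < ‖x j‖ ∧ ‖q‖ * ‖x j‖ < 1) (M : ℕ) :
    (1 - x 0 * q ^ (M + 1)) * (1 - q ^ (M + 1) / x 0) * baileySum 1 x q (M + 1) =
      baileySum 1 x q M + if M = 0 then 1 else 0 := by
  rw [← sub_eq_iff_eq_add', baileySum, baileySum, bailey_step_sum hq (ne_zero_of_norm_lt (hx 0)),
    ← bailey_base_sum hq M]
  refine Finset.sum_congr rfl fun n hn => ?_
  have hn' := (Finset.mem_Icc.mp hn).1
  have := one_sub_mul_pow_ne_zero hq (hx 0) hn'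
  have := one_sub_pow_div_ne_zero hq (hx 0) hn'
  rw [baileyCoeff]
  simp only [Fin.prod_univ_one, tsub_self, zero_mul, add_zero]
  rw [mul_assoc (q ^ _), mul_div_cancel₀]
  exact mul_ne_zero ‹_› ‹_›

/-- The extra `q^n` is what turns the `q^(L-n)` of the Bailey step into `q^L`, independent of `n`.
-/
theorem baileyCoeff_succ {q : ℂ} (hq : ‖q‖ < 1) {k : ℕ} (hk : 1 ≤ k) (x : Fin (k + 1) → ℂ)
    (hx : ∀ j, ‖q‖ < ‖x j‖ ∧ ‖q‖ * ‖x j‖ < 1) {n : ℕ} (hn : 1 ≤ n) :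
    ((1 - x (Fin.last k) * q ^ n) * (1 - q ^ n / x (Fin.last k))) * baileyCoeff (k + 1) x q n =
      q ^ n * baileyCoeff k (fun j => x j.castSucc) q n := by
  have h1 := one_sub_mul_pow_ne_zero hq (hx (Fin.last k)) hn
  have h2 := one_sub_pow_div_ne_zero hq (hx (Fin.last k)) hn
  have h3 := mul_ne_zero h1 h2
  have he : n * (n - 1) / 2 + (k + 1 - 1) * n = n * (n - 1) / 2 + (k - 1) * n + n := by
    obtain ⟨m, rfl⟩ := Nat.exists_eq_add_of_le' hk
    simp only [Nat.add_sub_cancel]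
    ring
  rw [baileyCoeff, baileyCoeff, Fin.prod_univ_castSucc, he, pow_add q _ n,
    mul_comm (∏ j : Fin k, _), ← mul_div_assoc, mul_div_mul_left _ _ h3, ← mul_div_assoc]
  congr 1
  ring

theorem baileySum_succ_step {q : ℂ} (hq : ‖q‖ < 1) {k : ℕ} (hk : 1 ≤ k) (x : Fin (k + 1) → ℂ)
    (hx : ∀ j, ‖q‖ < ‖x j‖ ∧ ‖q‖ * ‖x j‖ < 1) (M : ℕ) :
    (1 - x (Fin.last k) * q ^ (M + 1)) * (1 - q ^ (M + 1) / x (Fin.last k)) *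
        baileySum (k + 1) x q (M + 1) =
      baileySum (k + 1) x q M + q ^ (M + 1) * baileySum k (fun j => x j.castSucc) q (M + 1) := by
  rw [← sub_eq_iff_eq_add', baileySum, baileySum, bailey_step_sum hq (ne_zero_of_norm_lt (hx _)),
    baileySum, Finset.mul_sum]
  refine Finset.sum_congr rfl fun n hn => ?_
  have hn' := Finset.mem_Icc.mp hn
  rw [mul_assoc (q ^ _), baileyCoeff_succ hq hk x hx hn'.1, ← mul_assoc (q ^ _), ← pow_add,
    Nat.sub_add_cancel hn'.2, mul_assoc]

/-! ### Solving the recursion in `L` -/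

/-- The product `∏_{j=r}^{L} ((1 - x q^j) (1 - q^j / x))⁻¹`, the generating function of pairs of
partitions with parts between `r` and `L`, by rank and size. -/
noncomputable def pairProd (x q : ℂ) (r L : ℕ) : ℂ :=
  ∏ j ∈ Finset.Icc r L, ((1 - x * q ^ j) * (1 - q ^ j / x))⁻¹

theorem baileySum_one {q : ℂ} (hq : ‖q‖ < 1) (x : Fin 1 → ℂ)
    (hx : ∀ j, ‖q‖ < ‖x j‖ ∧ ‖q‖ * ‖x j‖ < 1) (M : ℕ) :
    baileySum 1 x q (M + 1) = pairProd (x 0) q 1 (M + 1) := by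
  have h0 (M : ℕ) : (1 - x 0 * q ^ (M + 1)) * (1 - q ^ (M + 1) / x 0) ≠ 0 :=
    mul_ne_zero (one_sub_mul_pow_ne_zero hq (hx 0) (by omega))
      (one_sub_pow_div_ne_zero hq (hx 0) (by omega))
  induction M with
  | zero =>
    apply mul_left_cancel₀ (h0 0)
    rw [baileySum_one_step hq x hx, baileySum_zero, pairProd, zero_add, Finset.Icc_self,
      Finset.prod_singleton, mul_inv_cancel₀ (h0 0)]
    simp
  | succ M ih =>
    apply mul_left_cancel₀ (h0 (M + 1))
    rw [baileySum_one_step hq x hx, ih, pairProd, pairProd,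
      Finset.prod_Icc_succ_top (b := M + 1) (by omega), mul_left_comm, mul_inv_cancel₀ (h0 (M + 1))]
    simp

/-- The inhomogeneous term that enters at level `r` is divided by the factors of all levels from `r`
to `L`. -/
theorem baileySum_succ {q : ℂ} (hq : ‖q‖ < 1) {k : ℕ} (hk : 1 ≤ k) (x : Fin (k + 1) → ℂ)
    (hx : ∀ j, ‖q‖ < ‖x j‖ ∧ ‖q‖ * ‖x j‖ < 1) (L : ℕ) :
    baileySum (k + 1) x q L = ∑ r ∈ Finset.Icc 1 L,
      q ^ r * baileySum k (fun j => x j.castSucc) q r * pairProd (x (Fin.last k)) q r L := by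
  induction L with
  | zero => simp [baileySum_zero]
  | succ M ih =>
    have h0 : (1 - x (Fin.last k) * q ^ (M + 1)) * (1 - q ^ (M + 1) / x (Fin.last k)) ≠ 0 :=
      mul_ne_zero (one_sub_mul_pow_ne_zero hq (hx _) (by omega))
        (one_sub_pow_div_ne_zero hq (hx _) (by omega))
    apply mul_left_cancel₀ h0
    rw [baileySum_succ_step hq hk x hx, ih, Finset.sum_Icc_succ_top (by omega), mul_add]
    congr 1
    · rw [Finset.mul_sum]
      refine Finset.sum_congr rfl fun r hr => ?_
      have := (Finset.mem_Icc.mp hr).2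
      rw [pairProd, pairProd, Finset.prod_Icc_succ_top (b := M) (by omega), mul_left_comm,
        mul_left_comm _ (∏ _ ∈ _, _), mul_inv_cancel₀ h0, mul_one]
    · rw [pairProd, Finset.Icc_self, Finset.prod_singleton, mul_left_comm, mul_inv_cancel₀ h0,
        mul_one]

/-! ### The Durfee rectangle identity -/

theorem tendsto_qFact {q : ℂ} (hq : ‖q‖ < 1) :
    Tendsto (qFact q) atTop (𝓝 (qPochInf q q)) := by
  have h := (multipliable_qPochInf q q hq).hasProd.tendsto_prod_nat
  unfold qFact qPochInf
  simpa only [← pow_succ'] using h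

theorem qPochInf_self_ne_zero {q : ℂ} (hq : ‖q‖ < 1) : qPochInf q q ≠ 0 := by
  have h : Summable fun j : ℕ => ‖-(q * q ^ j)‖ := by
    simpa [norm_mul, norm_pow] using
      (summable_geometric_of_lt_one (norm_nonneg q) hq).mul_left ‖q‖
  have := tprod_one_add_ne_zero_of_summable (f := fun j : ℕ => -(q * q ^ j)) (fun j => by
    rw [← sub_eq_add_neg, ← pow_succ']
    exact one_sub_pow_ne_zero hq (by omega)) h
  simpa only [qPochInf, ← sub_eq_add_neg] using this

theorem exists_norm_inv_qFact_le {q : ℂ} (hq : ‖q‖ < 1) :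
    ∃ C : ℝ, 0 ≤ C ∧ ∀ n, ‖(qFact q n)⁻¹‖ ≤ C := by
  obtain ⟨C, hC⟩ := ((tendsto_qFact hq).inv₀ (qPochInf_self_ne_zero hq)).norm.bddAbove_range
  have hC' (n : ℕ) : ‖(qFact q n)⁻¹‖ ≤ C := hC ⟨n, rfl⟩
  exact ⟨C, (norm_nonneg _).trans (hC' 0), hC'⟩

/-- The `m`-th term of the Durfee rectangle expansion of `1 / (q; q)_∞` with excess `N`. -/
noncomputable def durfeeTerm (q : ℂ) (N m : ℕ) : ℂ :=
  q ^ (m ^ 2 + m * N) * (qFact q m * qFact q (m + N))⁻¹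

theorem norm_mul_inv_qFact_le {q : ℂ} {C : ℝ} (hC0 : 0 ≤ C) (hC : ∀ n, ‖(qFact q n)⁻¹‖ ≤ C)
    (hq : ‖q‖ < 1) {a b : ℕ} (hab : a ≤ b) (m n : ℕ) :
    ‖q ^ b * (qFact q m * qFact q n)⁻¹‖ ≤ ‖q‖ ^ a * C ^ 2 := by
  rw [norm_mul, norm_pow, mul_inv, norm_mul, sq]
  gcongr ?_ * (?_ * ?_)
  · exact pow_le_pow_of_le_one (norm_nonneg _) hq.le hab
  · exact hC m
  · exact hC n

theorem summable_pow_mul_inv_qFact {q : ℂ} (hq : ‖q‖ < 1) (e f : ℕ → ℕ) (he : ∀ m, m ≤ e m) :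
    Summable fun m => q ^ e m * (qFact q m * qFact q (f m))⁻¹ := by
  obtain ⟨C, hC0, hC⟩ := exists_norm_inv_qFact_le hq
  exact .of_norm_bounded ((summable_geometric_of_lt_one (norm_nonneg q) hq).mul_right (C ^ 2))
    fun m => norm_mul_inv_qFact_le hC0 hC hq (he m) _ _

theorem le_sq_add (m a : ℕ) : m ≤ m ^ 2 + a :=
  (Nat.le_self_pow two_ne_zero m).trans (Nat.le_add_right _ _)

/-- The series `g N` interpolates between the two sides. Its difference from the left carries a
factor `1 - q^m`, which kills `m = 0` and permits a shift of `m`; its difference from the right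
comes from `(q;q)_{m+N+1} = (q;q)_{m+N} (1 - q^(m+N+1))`. Both differences equal `q^(N+1) ∑ g (N +
1)`. -/
theorem tsum_durfeeTerm_succ {q : ℂ} (hq : ‖q‖ < 1) (N : ℕ) :
    ∑' m, durfeeTerm q N m = ∑' m, durfeeTerm q (N + 1) m := by
  set g : ℕ → ℕ → ℂ := fun N m => q ^ (m ^ 2 + m * (N + 1)) * (qFact q m * qFact q (m + N))⁻¹
    with hg
  have sh (N : ℕ) : Summable (durfeeTerm q N) :=
    summable_pow_mul_inv_qFact hq _ (fun m => m + N) fun m => le_sq_add _ _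
  have sg (N : ℕ) : Summable (g N) :=
    summable_pow_mul_inv_qFact hq _ (fun m => m + N) fun m => le_sq_add _ _
  have h1 : ∑' m, durfeeTerm q N m - ∑' m, g N m = q ^ (N + 1) * ∑' m, g (N + 1) m := by
    rw [← (sh N).tsum_sub (sg N), ((sh N).sub (sg N)).tsum_eq_zero_add, ← tsum_mul_left]
    have h0 : durfeeTerm q N 0 - g N 0 = 0 := by simp [durfeeTerm, hg]
    rw [h0, zero_add]
    refine tsum_congr fun m => ?_
    have := one_sub_pow_ne_zero hq (n := m + 1) (by omega)
    have := qFact_ne_zero hq m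
    have := qFact_ne_zero hq (m + 1 + N)
    simp only [durfeeTerm, hg]
    rw [show m + (N + 1) = m + 1 + N by omega, qFact_succ]
    field_simp
    ring
  have h2 : ∑' m, g N m = ∑' m, durfeeTerm q (N + 1) m - q ^ (N + 1) * ∑' m, g (N + 1) m := by
    rw [← tsum_mul_left, ← (sh (N + 1)).tsum_sub ((sg (N + 1)).mul_left _)]
    refine tsum_congr fun m => ?_
    have := one_sub_pow_ne_zero hq (n := m + N + 1) (by omega)
    have := qFact_ne_zero hq m
    have := qFact_ne_zero hq (m + N)
    simp only [durfeeTerm, hg]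
    rw [← add_assoc m N 1, qFact_succ]
    field_simp
    ring
  linear_combination h1 + h2

/-- The Durfee rectangle identity `∑_m q^{m² + mN} / ((q; q)_m (q; q)_{m+N}) = 1 / (q; q)_∞`. -/
theorem hasSum_durfeeTerm {q : ℂ} (hq : ‖q‖ < 1) (N : ℕ) :
    HasSum (durfeeTerm q N) (qPochInf q q)⁻¹ := by
  obtain ⟨C, hC0, hC⟩ := exists_norm_inv_qFact_le hq
  have hconst (N : ℕ) : ∑' m, durfeeTerm q N m = ∑' m, durfeeTerm q 0 m := by
    induction N with
    | zero => rfl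
    | succ N ih => rw [← ih, tsum_durfeeTerm_succ hq N]
  -- The sum does not depend on `N`, and as `N → ∞` only the term `m = 0` survives.
  have hlim : Tendsto (fun N => ∑' m, durfeeTerm q N m) atTop
      (𝓝 (∑' m, if m = 0 then (qPochInf q q)⁻¹ else 0)) := by
    refine tendsto_tsum_of_dominated_convergence
      ((summable_geometric_of_lt_one (norm_nonneg q) hq).mul_right (C ^ 2)) (fun m => ?_)
      (Eventually.of_forall fun N m => norm_mul_inv_qFact_le hC0 hC hq (le_sq_add _ _) _ _)
    split_ifs with hm
    · subst hm
      simpa [durfeeTerm, qFact_zero] using (tendsto_qFact hq).inv₀ (qPochInf_self_ne_zero hq)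
    · refine squeeze_zero_norm (a := fun N => ‖q‖ ^ N * C ^ 2) (fun N => ?_) ?_
      · refine norm_mul_inv_qFact_le hC0 hC hq ?_ _ _
        exact (Nat.le_mul_of_pos_left N (Nat.pos_of_ne_zero hm)).trans (Nat.le_add_left _ _)
      · simpa using (tendsto_pow_atTop_nhds_zero_of_lt_one (norm_nonneg q) hq).mul_const (C ^ 2)
  rw [tsum_ite_eq] at hlim
  have h0 : ∑' m, durfeeTerm q N m = (qPochInf q q)⁻¹ := by
    simp only [hconst] at hlim ⊢
    exact tendsto_nhds_unique tendsto_const_nhds hlim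
  rw [← h0]
  exact (summable_pow_mul_inv_qFact hq _ (fun m => m + N) fun m => le_sq_add _ _).hasSum

/-! ### The limiting Bailey lemma -/

/-- The rational factor converges to `1`, hence is bounded; since `k ≥ 1`, the power of `q` is
dominated by a geometric series. -/
theorem summable_andrewsTerm {k : ℕ} (hk : 1 ≤ k) {q : ℂ} (hq : ‖q‖ < 1) (x : Fin k → ℂ) :
    Summable fun n : ℕ => andrewsTerm k x q (n + 1) := by
  have hpow : Tendsto (fun n : ℕ => q ^ (n + 1)) atTop (𝓝 0) :=
    (tendsto_pow_atTop_nhds_zero_of_norm_lt_one hq).comp (tendsto_add_atTop_nat 1)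
  have hlim : Tendsto (fun n : ℕ => ((1 + q ^ (n + 1)) * (1 - q ^ (n + 1)) ^ 2) /
      ∏ j, ((1 - x j * q ^ (n + 1)) * (1 - q ^ (n + 1) / x j))) atTop
      (𝓝 (((1 + 0) * (1 - 0) ^ 2) / ∏ j, ((1 - x j * 0) * (1 - 0 / x j)))) := by
    refine Tendsto.div ?_ ?_ (by simp)
    · exact (hpow.const_add 1).mul ((hpow.const_sub 1).pow 2)
    · exact tendsto_finsetProd _ fun j _ =>
        ((hpow.const_mul (x j)).const_sub 1).mul ((hpow.div_const (x j)).const_sub 1)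
  obtain ⟨C, hC⟩ := hlim.norm.bddAbove_range
  have hC' (n : ℕ) := hC ⟨n, rfl⟩
  refine .of_norm_bounded ((summable_geometric_of_lt_one (norm_nonneg q) hq).mul_right C)
    fun n => ?_
  rw [andrewsTerm, mul_div_assoc, norm_mul, norm_mul, norm_pow, norm_neg, norm_one, one_pow,
    one_mul, norm_pow]
  gcongr ?_ * ?_
  · refine pow_le_pow_of_le_one (norm_nonneg _) hq.le ?_
    exact (Nat.le_succ n).trans ((Nat.le_mul_of_pos_left (n + 1) hk).trans (Nat.le_add_left _ _))
  · exact hC' n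

theorem pow_sq_mul_baileyCoeff {k : ℕ} (hk : 1 ≤ k) (x : Fin k → ℂ) (q : ℂ) (n : ℕ) :
    q ^ (n ^ 2) * baileyCoeff k x q n = andrewsTerm k x q n := by
  have he : 3 * n * (n - 1) / 2 + k * n = n ^ 2 + (n * (n - 1) / 2 + (k - 1) * n) := by
    obtain ⟨l, rfl⟩ := Nat.exists_eq_add_of_le' hk
    rcases n with _ | n
    · simp
    · have h1 : 3 * (n + 1) * (n + 1 - 1) / 2 = (n + 1) * n + (n + 1) * (n + 1 - 1) / 2 := by
        rw [Nat.add_sub_cancel, ← Nat.mul_add_div two_pos]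
        congr 1
        ring
      rw [h1, Nat.add_sub_cancel l 1]
      ring
  rw [baileyCoeff, andrewsTerm, he, pow_add q (n ^ 2)]
  ring

theorem sum_Icc_one_eq_sum_range {M : Type*} [AddCommMonoid M] (f : ℕ → M) (L : ℕ) :
    ∑ n ∈ Finset.Icc 1 L, f n = ∑ n ∈ Finset.range L, f (n + 1) := by
  induction L with
  | zero => simp
  | succ L ih => rw [Finset.sum_Icc_succ_top (by omega), ih, Finset.sum_range_succ]

/-- The uniform majorant `b` makes the double series over `(n, m)` absolutely convergent. It may
then be summed by rows, each giving `a n * S`, or along the antidiagonals `n + m = L`. -/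
theorem hasSum_sum_range_mul {a : ℕ → ℂ} (ha : Summable a) {t : ℕ → ℕ → ℂ} {S : ℂ}
    (ht : ∀ n, HasSum (t n) S) {b : ℕ → ℝ} (hb : Summable b) (htb : ∀ n m, ‖t n m‖ ≤ b m) :
    HasSum (fun L => ∑ n ∈ Finset.range (L + 1), a n * t n (L - n)) (S * ∑' n, a n) := by
  have hb0 : ∀ m, 0 ≤ b m := fun m => (norm_nonneg _).trans (htb 0 m)
  have hsum : Summable fun p : ℕ × ℕ => a p.1 * t p.1 p.2 := by
    refine .of_norm_bounded (ha.norm.mul_of_nonneg hb (fun n => norm_nonneg _) hb0) fun p => ?_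
    rw [norm_mul]
    exact mul_le_mul_of_nonneg_left (htb _ _) (norm_nonneg _)
  have hval : HasSum (fun p : ℕ × ℕ => a p.1 * t p.1 p.2) (S * ∑' n, a n) := by
    have h := hsum.hasSum.prod_fiberwise fun n => (ht n).mul_left (a n)
    rw [mul_comm, (ha.hasSum.mul_right S).unique h]
    exact hsum.hasSum
  rw [← Finset.HasAntidiagonal.sigmaAntidiagonalEquivProd.hasSum_iff] at hval
  have h := hval.sigma fun L => hasSum_fintype _
  convert! h using 2 with L
  rw [← Finset.Nat.sum_antidiagonal_eq_sum_range_succ (fun n m => a n * t n m) L,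
    ← Finset.sum_coe_sort]
  rfl

/-- The limiting case of the Bailey lemma for the pair attached to `k`-marked Durfee symbols. -/
theorem hasSum_baileySum {k : ℕ} (hk : 1 ≤ k) {q : ℂ} (hq : ‖q‖ < 1) (x : Fin k → ℂ) :
    HasSum (fun L : ℕ => q ^ ((L + 1) ^ 2) * baileySum k x q (L + 1))
      (1 / qPochInf q q * ∑' n : ℕ, andrewsTerm k x q (n + 1)) := by
  obtain ⟨C, hC0, hC⟩ := exists_norm_inv_qFact_le hq
  have h := hasSum_sum_range_mul (summable_andrewsTerm hk hq x)
    (t := fun n m => durfeeTerm q (2 * (n + 1)) m) (fun n => hasSum_durfeeTerm hq _)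
    ((summable_geometric_of_lt_one (norm_nonneg q) hq).mul_right (C ^ 2))
    fun n m => norm_mul_inv_qFact_le hC0 hC hq (le_sq_add _ _) _ _
  rw [one_div]
  convert! h using 2 with L
  rw [baileySum, sum_Icc_one_eq_sum_range, Finset.mul_sum]
  refine Finset.sum_congr rfl fun n hn => ?_
  -- With `L = n + m`, the square `(L + 1)²` splits as `(n + 1)²` plus the exponent of the Durfee
  -- rectangle with excess `2(n + 1)`, and the kernel supplies the matching denominators.
  obtain ⟨m, rfl⟩ := Nat.exists_eq_add_of_le (Nat.lt_succ_iff.mp (Finset.mem_range.mp hn))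
  rw [← pow_sq_mul_baileyCoeff hk, baileyKernel, if_pos (by omega), durfeeTerm,
    Nat.add_sub_cancel_left, show n + m + 1 - (n + 1) = m by omega,
    show n + m + 1 + (n + 1) = m + 2 * (n + 1) by omega,
    show (n + m + 1) ^ 2 = (n + 1) ^ 2 + (m ^ 2 + m * (2 * (n + 1))) by ring, pow_add]
  ring

/-! ### Generating functions of multisets and of pairs of partitions -/

/-- The multisets all of whose elements lie in the finite set `s`. -/
abbrev MultisetIn (s : Finset ℕ) : Type :=
  {m : Multiset ℕ // ∀ a ∈ m, a ∈ s}

/-- Splitting off the multiplicity of a new element. -/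
def multisetInInsertEquiv {a : ℕ} {s : Finset ℕ} (ha : a ∉ s) :
    ℕ × MultisetIn s ≃ MultisetIn (insert a s) where
  toFun p := ⟨Multiset.replicate p.1 a + p.2.1, fun b hb => by
    rcases Multiset.mem_add.mp hb with h | h
    · rw [Multiset.eq_of_mem_replicate h]
      exact Finset.mem_insert_self _ _
    · exact Finset.mem_insert_of_mem (p.2.2 b h)⟩
  invFun m := (m.1.count a, ⟨m.1.filter (· ≠ a), fun b hb => by
    obtain ⟨h1, h2⟩ := Multiset.mem_filter.mp hb
    exact (Finset.mem_insert.mp (m.2 b h1)).resolve_left h2⟩)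
  left_inv := by
    rintro ⟨n, m, hm⟩
    have h : a ∉ m := fun h => ha (hm a h)
    have h1 : Multiset.filter (· ≠ a) m = m :=
      Multiset.filter_eq_self.mpr fun b hb => ne_of_mem_of_not_mem hb h
    have h2 : Multiset.filter (· ≠ a) (Multiset.replicate n a) = 0 :=
      Multiset.filter_eq_nil.mpr fun b hb => by simp [Multiset.eq_of_mem_replicate hb]
    ext1
    · simp [Multiset.count_eq_zero_of_notMem h]
    · apply Subtype.ext
      simp only [Multiset.filter_add, h1, h2, zero_add]
  right_inv := by
    rintro ⟨m, hm⟩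
    apply Subtype.ext
    simp only
    rw [← Multiset.filter_eq']
    exact Multiset.filter_add_not _ _

theorem hasSum_mul_complex {ι κ : Type*} {f : ι → ℂ} {g : κ → ℂ} {a b : ℂ} (hf : HasSum f a)
    (hg : HasSum g b) : HasSum (fun p : ι × κ => f p.1 * g p.2) (a * b) :=
  hf.mul hg (summable_mul_of_summable_norm hf.summable.norm hg.summable.norm)

/-- The generating function of multisets with elements in a finite set. -/
theorem hasSum_multisetIn (w : ℕ → ℂ) (s : Finset ℕ) (hw : ∀ a ∈ s, ‖w a‖ < 1) :
    HasSum (fun m : MultisetIn s => (m.1.map w).prod) (∏ a ∈ s, (1 - w a)⁻¹) := by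
  induction s using Finset.induction_on with
  | empty =>
    have h0 (m : MultisetIn ∅) : m = ⟨0, by simp⟩ :=
      Subtype.ext (Multiset.eq_zero_of_forall_notMem fun a ha => by simpa using m.2 a ha)
    rw [Finset.prod_empty]
    simpa using hasSum_single (f := fun m : MultisetIn ∅ => (m.1.map w).prod) _
      fun m hm => absurd (h0 m) hm
  | insert a s ha ih =>
    have h1 := hasSum_geometric_of_norm_lt_one (hw a (Finset.mem_insert_self _ _))
    have h2 := ih fun b hb => hw b (Finset.mem_insert_of_mem hb)
    rw [Finset.prod_insert ha, ← (multisetInInsertEquiv ha).hasSum_iff]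
    convert! hasSum_mul_complex h1 h2 using 2 with p
    simp [multisetInInsertEquiv]

theorem prod_map_mul_pow (y q : ℂ) (m : Multiset ℕ) :
    (m.map fun a => y * q ^ a).prod = y ^ m.card * q ^ m.sum := by
  induction m using Multiset.induction_on with
  | empty => simp
  | cons a m ih =>
    simp only [Multiset.map_cons, Multiset.prod_cons, Multiset.card_cons, Multiset.sum_cons, ih]
    ring

/-- The contribution `x^{l(A) - l(B)} q^{|A| + |B|}` of a pair of partitions. -/
noncomputable def pairTerm (x q : ℂ) (A B : Multiset ℕ) : ℂ :=
  x ^ ((A.card : ℤ) - B.card) * q ^ (A.sum + B.sum)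

theorem hasSum_pairTerm {q x : ℂ} (hq : ‖q‖ < 1) (hx : ‖q‖ < ‖x‖ ∧ ‖q‖ * ‖x‖ < 1) {r : ℕ}
    (hr : 1 ≤ r) (L : ℕ) :
    HasSum (fun p : MultisetIn (Finset.Icc r L) × MultisetIn (Finset.Icc r L) =>
      pairTerm x q p.1.1 p.2.1) (pairProd x q r L) := by
  have h1 := hasSum_multisetIn (fun a => x * q ^ a) (Finset.Icc r L) fun a ha =>
    norm_mul_pow_lt_one hq (by rw [mul_comm]; exact hx.2) (hr.trans (Finset.mem_Icc.mp ha).1)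
  have h2 := hasSum_multisetIn (fun a => x⁻¹ * q ^ a) (Finset.Icc r L) fun a ha =>
    norm_mul_pow_lt_one hq (norm_inv_mul_lt_one hx) (hr.trans (Finset.mem_Icc.mp ha).1)
  have h := hasSum_mul_complex h1 h2
  convert! h using 1
  · ext p
    rw [prod_map_mul_pow, prod_map_mul_pow, pairTerm, zpow_sub₀ (ne_zero_of_norm_lt hx),
      zpow_natCast, zpow_natCast, pow_add, inv_pow]
    ring
  · rw [pairProd, ← Finset.prod_mul_distrib]
    refine Finset.prod_congr rfl fun j _ => ?_
    rw [mul_inv, div_eq_inv_mul]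

/-! ### Appending and removing the last vector of a symbol -/

namespace MarkedDurfeeSymbol

/-- The contribution of a symbol to the generating function by ranks, without the square of the
subscript. -/
noncomputable def term {k : ℕ} (x : Fin k → ℂ) (q : ℂ) (η : MarkedDurfeeSymbol k) : ℂ :=
  (∏ i, x i ^ η.rank i) * q ^ ∑ i, ((η.α i).sum + (η.β i).sum)

/-- A `1`-marked Durfee symbol is a pair of partitions. -/
def ofPair (L : ℕ) (p : MultisetIn (Finset.Icc 1 L) × MultisetIn (Finset.Icc 1 L)) :
    MarkedDurfeeSymbol 1 where
  D := L
  α _ := p.1.1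
  β _ := p.2.1
  α_pos _ a ha := (Finset.mem_Icc.mp (p.1.2 a ha)).1
  β_pos _ b hb := (Finset.mem_Icc.mp (p.2.2 b hb)).1
  α_nonempty i hi := by omega
  β_sup_le i hi := by omega
  sup_le_α i j hij := by omega
  sup_le_β i j hij := by omega
  α_le _ a ha := (Finset.mem_Icc.mp (p.1.2 a ha)).2
  β_le _ b hb := (Finset.mem_Icc.mp (p.2.2 b hb)).2

theorem ofPair_injective (L : ℕ) : Function.Injective (ofPair L) := by
  intro p p' h
  have hα := congrArg (fun η => η.α 0) h
  have hβ := congrArg (fun η => η.β 0) h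
  exact Prod.ext (Subtype.ext hα) (Subtype.ext hβ)

theorem mem_range_ofPair {L : ℕ} {η : MarkedDurfeeSymbol 1} (h : η.D = L) :
    η ∈ Set.range (ofPair L) := by
  subst h
  refine ⟨(⟨η.α 0, fun a ha => Finset.mem_Icc.mpr ⟨η.α_pos 0 a ha, η.α_le 0 a ha⟩⟩,
    ⟨η.β 0, fun b hb => Finset.mem_Icc.mpr ⟨η.β_pos 0 b hb, η.β_le 0 b hb⟩⟩), ?_⟩
  refine MarkedDurfeeSymbol.ext rfl (funext fun i => ?_) (funext fun i => ?_) <;>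
    rw [Subsingleton.elim i 0] <;> rfl

theorem term_ofPair (x : Fin 1 → ℂ) (q : ℂ) (L : ℕ)
    (p : MultisetIn (Finset.Icc 1 L) × MultisetIn (Finset.Icc 1 L)) :
    (ofPair L p).term x q = pairTerm (x 0) q p.1.1 p.2.1 := by
  simp [term, pairTerm, rank, ofPair]

variable {l : ℕ}

theorem sup_α_le {k : ℕ} (η : MarkedDurfeeSymbol k) (i : Fin k) : (η.α i).sup ≤ η.D :=
  Multiset.sup_le.mpr (η.α_le i)

theorem sup_β_le {k : ℕ} (η : MarkedDurfeeSymbol k) (i : Fin k) : (η.β i).sup ≤ η.D :=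
  Multiset.sup_le.mpr (η.β_le i)

/-- Nonemptiness provides a part through which consecutive maxima are compared. The last vector is
excluded, since its top partition may be empty with `sup` equal to `0`. -/
theorem sup_α_mono {k : ℕ} (η : MarkedDurfeeSymbol k) (i : Fin k) (d : ℕ)
    (h : (i : ℕ) + d + 1 < k) : (η.α i).sup ≤ (η.α ⟨i + d, by omega⟩).sup := by
  induction d with
  | zero => exact le_rfl
  | succ d ih =>
    obtain ⟨a, ha⟩ := Multiset.exists_mem_of_ne_zero
      (η.α_nonempty ⟨i + (d + 1), by omega⟩ (by simpa using by omega))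
    exact (ih (by omega)).trans ((η.sup_le_α _ _ (by simp; omega) a ha).trans
      (Multiset.le_sup ha))

theorem sup_α_le_penultimate (η : MarkedDurfeeSymbol (l + 2)) (i : Fin (l + 1)) :
    (η.α i.castSucc).sup ≤ (η.α (Fin.last l).castSucc).sup := by
  have hi : (i : ℕ) + (l - i) = l := by omega
  have h := η.sup_α_mono i.castSucc (l - i) (by simp; omega)
  have he : (⟨(i.castSucc : ℕ) + (l - i), by simp; omega⟩ : Fin (l + 2)) =
      (Fin.last l).castSucc := Fin.ext (by simp [hi])
  rwa [he] at h

/-- The top row after appending a vector: the former last top partition receives a part equal to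
the former subscript. -/
def extendTop (η : MarkedDurfeeSymbol (l + 1)) (A : Multiset ℕ) : Fin (l + 2) → Multiset ℕ :=
  Fin.snoc (α := fun _ => Multiset ℕ)
    (fun i => if i = Fin.last l then η.D ::ₘ η.α i else η.α i) A

/-- The bottom row after appending a vector. -/
def extendBot (η : MarkedDurfeeSymbol (l + 1)) (B : Multiset ℕ) : Fin (l + 2) → Multiset ℕ :=
  Fin.snoc (α := fun _ => Multiset ℕ) η.β B

@[simp]
theorem extendTop_last (η : MarkedDurfeeSymbol (l + 1)) (A : Multiset ℕ) :
    extendTop η A (Fin.last (l + 1)) = A := by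
  simp [extendTop]

@[simp]
theorem extendTop_castSucc (η : MarkedDurfeeSymbol (l + 1)) (A : Multiset ℕ) (i : Fin (l + 1)) :
    extendTop η A i.castSucc = if i = Fin.last l then η.D ::ₘ η.α i else η.α i := by
  simp only [extendTop, Fin.snoc_castSucc]

@[simp]
theorem extendBot_last (η : MarkedDurfeeSymbol (l + 1)) (B : Multiset ℕ) :
    extendBot η B (Fin.last (l + 1)) = B := by
  simp [extendBot]

@[simp]
theorem extendBot_castSucc (η : MarkedDurfeeSymbol (l + 1)) (B : Multiset ℕ) (i : Fin (l + 1)) :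
    extendBot η B i.castSucc = η.β i := by
  simp only [extendBot, Fin.snoc_castSucc]

theorem mem_extendTop_castSucc {η : MarkedDurfeeSymbol (l + 1)} {A : Multiset ℕ}
    {i : Fin (l + 1)} {a : ℕ} (h : a ∈ extendTop η A i.castSucc) :
    (i = Fin.last l ∧ a = η.D) ∨ a ∈ η.α i := by
  rw [extendTop_castSucc] at h
  split_ifs at h with hi
  · rcases Multiset.mem_cons.mp h with h | h
    · exact .inl ⟨hi, h⟩
    · exact .inr h
  · exact .inr h

theorem sup_extendTop_last (η : MarkedDurfeeSymbol (l + 1)) (A : Multiset ℕ) :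
    (extendTop η A (Fin.last l).castSucc).sup = η.D := by
  rw [extendTop_castSucc, if_pos rfl, Multiset.sup_cons]
  exact sup_eq_left.mpr (η.sup_α_le _)

theorem sup_extendTop_le (η : MarkedDurfeeSymbol (l + 1)) (A : Multiset ℕ) (i : Fin (l + 1)) :
    (extendTop η A i.castSucc).sup ≤ η.D := by
  refine Multiset.sup_le.mpr fun a ha => ?_
  rcases mem_extendTop_castSucc ha with h | h
  · exact h.2.le
  · exact η.α_le i a h

/-- Appending a vector to a symbol with positive subscript. -/
def extend {r L : ℕ} (hr : r ∈ Finset.Icc 1 L)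
    (p : {η : MarkedDurfeeSymbol (l + 1) // η.D = r} ×
      (MultisetIn (Finset.Icc r L) × MultisetIn (Finset.Icc r L))) :
    MarkedDurfeeSymbol (l + 2) where
  D := L
  α := extendTop p.1.1 p.2.1.1
  β := extendBot p.1.1 p.2.2.1
  α_pos := by
    obtain ⟨⟨η, rfl⟩, ⟨A, hA⟩, ⟨B, hB⟩⟩ := p
    rw [Finset.mem_Icc] at hr
    refine Fin.lastCases (fun a ha => ?_) fun i a ha => ?_
    · rw [extendTop_last] at ha
      exact hr.1.trans (Finset.mem_Icc.mp (hA a ha)).1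
    · rcases mem_extendTop_castSucc ha with h | h
      · exact h.2 ▸ hr.1
      · exact η.α_pos i a h
  β_pos := by
    obtain ⟨⟨η, rfl⟩, ⟨A, hA⟩, ⟨B, hB⟩⟩ := p
    rw [Finset.mem_Icc] at hr
    refine Fin.lastCases (fun b hb => ?_) fun i b hb => ?_
    · rw [extendBot_last] at hb
      exact hr.1.trans (Finset.mem_Icc.mp (hB b hb)).1
    · rw [extendBot_castSucc] at hb
      exact η.β_pos i b hb
  α_nonempty := by
    refine Fin.lastCases (fun h => ?_) fun i _ => ?_
    · simp at h
    · rw [extendTop_castSucc]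
      split_ifs with hi
      · exact Multiset.cons_ne_zero
      · refine p.1.1.α_nonempty i ?_
        have := Fin.val_ne_of_ne hi
        simp only [Fin.val_last] at this
        omega
  β_sup_le := by
    refine Fin.lastCases (fun h => ?_) fun i _ => ?_
    · simp at h
    · rw [extendBot_castSucc]
      rcases eq_or_ne i (Fin.last l) with rfl | hi
      -- The old subscript, which bounds the bottom partition, is now the maximum of the top one.
      · rw [sup_extendTop_last]
        exact p.1.1.sup_β_le _
      · rw [extendTop_castSucc, if_neg hi]
        refine p.1.1.β_sup_le i ?_
        have := Fin.val_ne_of_ne hi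
        simp only [Fin.val_last] at this
        omega
  sup_le_α := by
    obtain ⟨⟨η, rfl⟩, ⟨A, hA⟩, ⟨B, hB⟩⟩ := p
    refine Fin.lastCases (fun j h => ?_) fun i => Fin.lastCases (fun h a ha => ?_)
      fun j h a ha => ?_
    · simp at h
      omega
    · rw [extendTop_last] at ha
      exact (sup_extendTop_le η A i).trans (Finset.mem_Icc.mp (hA a ha)).1
    · simp only [Fin.val_castSucc] at h
      have hi : i ≠ Fin.last l := by
        rintro rfl
        simp at h
        omega
      rcases mem_extendTop_castSucc ha with h' | h'
      · exact (sup_extendTop_le η A i).trans h'.2.ge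
      · rw [extendTop_castSucc, if_neg hi]
        exact η.sup_le_α i j h a h'
  sup_le_β := by
    obtain ⟨⟨η, rfl⟩, ⟨A, hA⟩, ⟨B, hB⟩⟩ := p
    refine Fin.lastCases (fun j h => ?_) fun i => Fin.lastCases (fun h b hb => ?_)
      fun j h b hb => ?_
    · simp at h
      omega
    · rw [extendBot_last] at hb
      exact (sup_extendTop_le η A i).trans (Finset.mem_Icc.mp (hB b hb)).1
    · simp only [Fin.val_castSucc] at h
      have hi : i ≠ Fin.last l := by
        rintro rfl
        simp at h
        omega
      rw [extendBot_castSucc] at hb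
      rw [extendTop_castSucc, if_neg hi]
      exact η.sup_le_β i j h b hb
  α_le := by
    obtain ⟨⟨η, rfl⟩, ⟨A, hA⟩, ⟨B, hB⟩⟩ := p
    rw [Finset.mem_Icc] at hr
    refine Fin.lastCases (fun a ha => ?_) fun i a ha => ?_
    · rw [extendTop_last] at ha
      exact (Finset.mem_Icc.mp (hA a ha)).2
    · exact (Multiset.le_sup ha).trans ((sup_extendTop_le η A i).trans hr.2)
  β_le := by
    obtain ⟨⟨η, rfl⟩, ⟨A, hA⟩, ⟨B, hB⟩⟩ := p
    rw [Finset.mem_Icc] at hr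
    refine Fin.lastCases (fun b hb => ?_) fun i b hb => ?_
    · rw [extendBot_last] at hb
      exact (Finset.mem_Icc.mp (hB b hb)).2
    · rw [extendBot_castSucc] at hb
      exact (η.β_le i b hb).trans hr.2

theorem extend_injective {r L : ℕ} (hr : r ∈ Finset.Icc 1 L) :
    Function.Injective (extend (l := l) hr) := by
  rintro ⟨⟨η, hη⟩, ⟨A, hA⟩, ⟨B, hB⟩⟩ ⟨⟨η', hη'⟩, ⟨A', hA'⟩, ⟨B', hB'⟩⟩ h
  have hα : extendTop η A = extendTop η' A' := congrArg (fun η => η.α) h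
  have hβ : extendBot η B = extendBot η' B' := congrArg (fun η => η.β) h
  obtain rfl : A = A' := by simpa using congrFun hα (Fin.last (l + 1))
  obtain rfl : B = B' := by simpa using congrFun hβ (Fin.last (l + 1))
  obtain rfl : η = η' := by
    refine MarkedDurfeeSymbol.ext (hη.trans hη'.symm) (funext fun i => ?_) (funext fun i => ?_)
    · have hi := congrFun hα i.castSucc
      rw [extendTop_castSucc, extendTop_castSucc] at hi
      split_ifs at hi
      · rwa [hη, hη', Multiset.cons_inj_right] at hi
      · exact hi
    · simpa using congrFun hβ i.castSucc
  rfl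

/-- Removing the last vector, together with a largest part of the top partition before it. -/
def restrict (η : MarkedDurfeeSymbol (l + 2)) : MarkedDurfeeSymbol (l + 1) where
  D := (η.α (Fin.last l).castSucc).sup
  α i := if i = Fin.last l then
    (η.α i.castSucc).erase (η.α (Fin.last l).castSucc).sup else η.α i.castSucc
  β i := η.β i.castSucc
  α_pos i a ha := by
    refine η.α_pos i.castSucc a ?_
    split_ifs at ha
    · exact Multiset.mem_of_mem_erase ha
    · exact ha
  β_pos i := η.β_pos i.castSucc
  α_nonempty i hi := by
    have : i ≠ Fin.last l := by
      rintro rfl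
      simp at hi
    rw [if_neg this]
    exact η.α_nonempty i.castSucc (by simp; omega)
  β_sup_le i hi := by
    have : i ≠ Fin.last l := by
      rintro rfl
      simp at hi
    rw [if_neg this]
    exact η.β_sup_le i.castSucc (by simp; omega)
  sup_le_α i j hij a ha := by
    have : i ≠ Fin.last l := by
      rintro rfl
      simp at hij
      omega
    rw [if_neg this]
    refine η.sup_le_α i.castSucc j.castSucc (by simpa using hij) a ?_
    split_ifs at ha
    · exact Multiset.mem_of_mem_erase ha
    · exact ha
  sup_le_β i j hij b hb := by
    have : i ≠ Fin.last l := by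
      rintro rfl
      simp at hij
      omega
    rw [if_neg this]
    exact η.sup_le_β i.castSucc j.castSucc (by simpa using hij) b hb
  α_le i a ha := by
    refine (Multiset.le_sup (s := η.α i.castSucc) ?_).trans (η.sup_α_le_penultimate i)
    split_ifs at ha
    · exact Multiset.mem_of_mem_erase ha
    · exact ha
  -- No vector of the restriction was the last one of `η`, so its bottom parts are bounded by the
  -- top maxima and hence by the new subscript.
  β_le i b hb := (Multiset.le_sup hb).trans
    ((η.β_sup_le i.castSucc (by simp; omega)).trans (η.sup_α_le_penultimate i))

theorem sup_mem {s : Multiset ℕ} (hs : s ≠ 0) : s.sup ∈ s := by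
  induction s using Multiset.induction_on with
  | empty => exact absurd rfl hs
  | cons a s ih =>
    rw [Multiset.sup_cons]
    rcases le_total s.sup a with h | h
    · rw [sup_eq_left.mpr h]
      exact Multiset.mem_cons_self _ _
    · rw [sup_eq_right.mpr h]
      rcases eq_or_ne s 0 with rfl | hs'
      · obtain rfl : a = 0 := by simpa using h
        simp
      · exact Multiset.mem_cons_of_mem (ih hs')

theorem sup_penultimate_mem (η : MarkedDurfeeSymbol (l + 2)) :
    (η.α (Fin.last l).castSucc).sup ∈ η.α (Fin.last l).castSucc :=
  sup_mem (η.α_nonempty _ (by simp))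

/-- The preimage is `restrict η` together with the last vector, whose parts are at least `r` by the
interlacing condition. -/
theorem mem_range_extend {r L : ℕ} (hr : r ∈ Finset.Icc 1 L) {η : MarkedDurfeeSymbol (l + 2)}
    (hD : η.D = L) (hs : (η.α (Fin.last l).castSucc).sup = r) :
    η ∈ Set.range (extend (l := l) hr) := by
  subst hD hs
  refine ⟨(⟨η.restrict, rfl⟩, ⟨η.α (Fin.last (l + 1)), fun a ha => Finset.mem_Icc.mpr
    ⟨η.sup_le_α _ _ (by simp) a ha, η.α_le _ a ha⟩⟩, ⟨η.β (Fin.last (l + 1)), fun b hb =>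
    Finset.mem_Icc.mpr ⟨η.sup_le_β _ _ (by simp) b hb, η.β_le _ b hb⟩⟩), ?_⟩
  refine MarkedDurfeeSymbol.ext rfl (funext ?_) (funext ?_)
  · refine Fin.lastCases ?_ fun i => ?_
    · exact extendTop_last _ _
    · refine (extendTop_castSucc _ _ _).trans ?_
      rcases eq_or_ne i (Fin.last l) with rfl | hi
      · simp only [restrict, if_true]
        exact Multiset.cons_erase η.sup_penultimate_mem
      · simp only [restrict, if_neg hi]
  · refine Fin.lastCases ?_ fun i => ?_
    · exact extendBot_last _ _
    · exact extendBot_castSucc _ _ _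

theorem sup_penultimate_extend {r L : ℕ} (hr : r ∈ Finset.Icc 1 L)
    (p : {η : MarkedDurfeeSymbol (l + 1) // η.D = r} ×
      (MultisetIn (Finset.Icc r L) × MultisetIn (Finset.Icc r L))) :
    ((extend hr p).α (Fin.last l).castSucc).sup = r :=
  (sup_extendTop_last _ _).trans p.1.2

theorem term_extend (x : Fin (l + 2) → ℂ) (q : ℂ) {r L : ℕ} (hr : r ∈ Finset.Icc 1 L)
    (p : {η : MarkedDurfeeSymbol (l + 1) // η.D = r} ×
      (MultisetIn (Finset.Icc r L) × MultisetIn (Finset.Icc r L))) :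
    (extend hr p).term x q = q ^ r * p.1.1.term (fun j => x j.castSucc) q *
      pairTerm (x (Fin.last (l + 1))) q p.2.1.1 p.2.2.1 := by
  -- For the formerly last vector, the added part offsets the `-1` that now enters its rank.
  have hrank (i : Fin (l + 1)) : (extend hr p).rank i.castSucc = p.1.1.rank i := by
    simp only [rank, extend, extendTop_castSucc, extendBot_castSucc]
    rcases eq_or_ne i (Fin.last l) with rfl | hi
    · simp
      ring
    · have : (i : ℕ) < l := by
        have := Fin.val_ne_of_ne hi
        simp only [Fin.val_last] at this
        omega
      simp [hi, this]
      omega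
  have hlast : (extend hr p).rank (Fin.last (l + 1)) =
      ((p.2.1.1.card : ℤ) - p.2.2.1.card) := by
    simp [rank, extend]
  have hsum : ∑ i, (((extend hr p).α i).sum + ((extend hr p).β i).sum) =
      r + ∑ i, ((p.1.1.α i).sum + (p.1.1.β i).sum) + (p.2.1.1.sum + p.2.2.1.sum) := by
    simp only [extend]
    rw [Fin.sum_univ_castSucc, extendTop_last, extendBot_last, Fin.sum_univ_castSucc,
      Fin.sum_univ_castSucc (n := l)]
    simp only [extendTop_castSucc, extendBot_castSucc, if_true, Multiset.sum_cons, p.1.2,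
      (Fin.castSucc_lt_last _).ne, if_false]
    ring
  rw [term, hsum, Fin.prod_univ_castSucc, hlast, term, pairTerm, pow_add, pow_add]
  simp only [hrank]
  ring

/-! ### Generating functions for a fixed subscript -/

theorem hasSum_term_one_of_D {q : ℂ} (hq : ‖q‖ < 1) (x : Fin 1 → ℂ)
    (hx : ∀ j, ‖q‖ < ‖x j‖ ∧ ‖q‖ * ‖x j‖ < 1) (L : ℕ) :
    HasSum (fun η : {η : MarkedDurfeeSymbol 1 // η.D = L} => η.1.term x q)
      (pairProd (x 0) q 1 L) := by
  refine (Equiv.hasSum_iff (Equiv.ofBijective (fun p => (⟨ofPair L p, rfl⟩ :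
    {η : MarkedDurfeeSymbol 1 // η.D = L})) ⟨fun p p' hp => ?_, fun η => ?_⟩)).mp ?_
  · exact ofPair_injective _ (congrArg Subtype.val hp)
  · obtain ⟨p, hp⟩ := mem_range_ofPair η.2
    exact ⟨p, Subtype.ext hp⟩
  · convert! hasSum_pairTerm hq (hx 0) le_rfl L using 2 with p
    exact term_ofPair x q _ p

/-- The generating function of the symbols with a given positive subscript. -/
theorem hasSum_term_of_D {q : ℂ} (hq : ‖q‖ < 1) (l : ℕ) (x : Fin (l + 1) → ℂ)
    (hx : ∀ j, ‖q‖ < ‖x j‖ ∧ ‖q‖ * ‖x j‖ < 1) {L : ℕ} (hL : 1 ≤ L) :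
    HasSum (fun η : {η : MarkedDurfeeSymbol (l + 1) // η.D = L} => η.1.term x q)
      (baileySum (l + 1) x q L) := by
  induction l generalizing L with
  | zero =>
    obtain ⟨M, rfl⟩ := Nat.exists_eq_add_of_le' hL
    rw [baileySum_one hq x hx]
    exact hasSum_term_one_of_D hq x hx _
  | succ l ih =>
    have h (r : ℕ) (hr : r ∈ Finset.Icc 1 L) :
        HasSum (fun η : MarkedDurfeeSymbol (l + 2) =>
          if η.D = L ∧ (η.α (Fin.last l).castSucc).sup = r then η.term x q else 0)
          (q ^ r * baileySum (l + 1) (fun j => x j.castSucc) q r *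
            pairProd (x (Fin.last (l + 1))) q r L) := by
      have hr1 := (Finset.mem_Icc.mp hr).1
      have h1 := (ih (fun j => x j.castSucc) (fun j => hx _) hr1).mul_left (q ^ r)
      have h2 := hasSum_pairTerm hq (hx (Fin.last (l + 1))) hr1 L
      have h3 := hasSum_mul_complex h1 h2
      -- For each `r` the summand lives on all symbols and vanishes off the range of `extend hr`, so
      -- the finitely many `r` can be added termwise.
      rw [← (extend_injective hr).hasSum_iff]
      · convert! h3 using 2 with p
        rw [← term_extend]
        exact if_pos ⟨rfl, sup_penultimate_extend hr p⟩
      · exact fun η hη => if_neg fun h => hη (mem_range_extend hr h.1 h.2)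
    have hs := hasSum_sum h
    rw [← baileySum_succ hq (by omega) x hx] at hs
    change HasSum ((fun η => term x q η) ∘
      (Subtype.val : {η : MarkedDurfeeSymbol (l + 2) | η.D = L} → _)) _
    rw [hasSum_subtype_iff_indicator]
    convert! hs using 2 with η
    by_cases hη : η.D = L
    · have hmem : (η.α (Fin.last l).castSucc).sup ∈ Finset.Icc 1 L :=
        Finset.mem_Icc.mpr ⟨η.α_pos _ _ η.sup_penultimate_mem, hη ▸ η.sup_α_le _⟩
      simp [hη, hmem, -Finset.mem_Icc]
    · simp [hη]

end MarkedDurfeeSymbol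

/-! ### Summing over subscripts and grouping by ranks -/

namespace MarkedDurfeeSymbol

/-- Subscript `0` leaves no room for a part, while two or more vectors force a nonempty top
partition. -/
theorem hasSum_term_of_D_zero {q : ℂ} (hq : ‖q‖ < 1) (l : ℕ) (x : Fin (l + 1) → ℂ)
    (hx : ∀ j, ‖q‖ < ‖x j‖ ∧ ‖q‖ * ‖x j‖ < 1) :
    HasSum (fun η : {η : MarkedDurfeeSymbol (l + 1) // η.D = 0} => η.1.term x q)
      (if l + 1 = 1 then 1 else 0) := by
  rcases l with _ | l
  · simpa [pairProd] using hasSum_term_one_of_D hq x hx 0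
  · have : IsEmpty {η : MarkedDurfeeSymbol (l + 2) // η.D = 0} := ⟨fun η => by
      have h1 := η.1.α_pos _ _ η.1.sup_penultimate_mem
      have h2 := η.1.sup_α_le (Fin.last l).castSucc
      have h3 := η.2
      omega⟩
    simp

/-- The contribution of a symbol to the generating function by ranks. -/
noncomputable def fullTerm {k : ℕ} (x : Fin k → ℂ) (q : ℂ) (η : MarkedDurfeeSymbol k) : ℂ :=
  (∏ i, x i ^ η.rank i) * q ^ η.weight

theorem fullTerm_eq {k : ℕ} (x : Fin k → ℂ) (q : ℂ) (η : MarkedDurfeeSymbol k) :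
    η.fullTerm x q = q ^ η.D ^ 2 * η.term x q := by
  rw [fullTerm, term, weight, pow_add]
  ring

theorem ofReal_norm_fullTerm {k : ℕ} (x : Fin k → ℂ) (q : ℂ) (η : MarkedDurfeeSymbol k) :
    ((‖η.fullTerm x q‖ : ℝ) : ℂ) = η.fullTerm (fun j => ((‖x j‖ : ℝ) : ℂ)) ((‖q‖ : ℝ) : ℂ) := by
  simp [fullTerm, norm_prod, norm_zpow]

/-- The generating function of all symbols with subscript `L`. -/
noncomputable def fiberSum (k : ℕ) (x : Fin k → ℂ) (q : ℂ) : ℕ → ℂ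
  | 0 => if k = 1 then 1 else 0
  | L + 1 => q ^ (L + 1) ^ 2 * baileySum k x q (L + 1)

theorem hasSum_fullTerm_of_D {k : ℕ} (hk : 1 ≤ k) {q : ℂ} (hq : ‖q‖ < 1) (x : Fin k → ℂ)
    (hx : ∀ j, ‖q‖ < ‖x j‖ ∧ ‖q‖ * ‖x j‖ < 1) (L : ℕ) :
    HasSum (fun η : {η : MarkedDurfeeSymbol k // η.D = L} => η.1.fullTerm x q)
      (fiberSum k x q L) := by
  obtain ⟨l, rfl⟩ := Nat.exists_eq_add_of_le' hk
  have he (η : {η : MarkedDurfeeSymbol (l + 1) // η.D = L}) :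
      η.1.fullTerm x q = q ^ L ^ 2 * η.1.term x q := by
    rw [fullTerm_eq, η.2]
  simp only [he]
  rcases L with _ | L
  · simpa [fiberSum] using hasSum_term_of_D_zero hq l x hx
  · exact (hasSum_term_of_D hq l x hx (by omega)).mul_left _

theorem hasSum_fiberSum {k : ℕ} (hk : 1 ≤ k) {q : ℂ} (hq : ‖q‖ < 1) (x : Fin k → ℂ) :
    HasSum (fiberSum k x q)
      ((if k = 1 then 1 else 0) +
        1 / qPochInf q q * ∑' n : ℕ, andrewsTerm k x q (n + 1)) :=
  HasSum.zero_add (hasSum_baileySum hk hq x)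

/-- The norm of a term is the same term at `‖q‖`, `‖x j‖`, which satisfy the same inequalities. So
the norms sum over each subscript to `fiberSum` at these values, which is summable. -/
theorem summable_fullTerm {k : ℕ} (hk : 1 ≤ k) {q : ℂ} (hq : ‖q‖ < 1) (x : Fin k → ℂ)
    (hx : ∀ j, ‖q‖ < ‖x j‖ ∧ ‖q‖ * ‖x j‖ < 1) :
    Summable fun η : MarkedDurfeeSymbol k => η.fullTerm x q := by
  have hq' : ‖((‖q‖ : ℝ) : ℂ)‖ < 1 := by simpa using hq
  have hx' : ∀ j, ‖((‖q‖ : ℝ) : ℂ)‖ < ‖((‖x j‖ : ℝ) : ℂ)‖ ∧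
      ‖((‖q‖ : ℝ) : ℂ)‖ * ‖((‖x j‖ : ℝ) : ℂ)‖ < 1 := by simpa using hx
  apply Summable.of_norm
  rw [← (Equiv.sigmaFiberEquiv fun η : MarkedDurfeeSymbol k => η.D).summable_iff]
  refine (summable_sigma_of_nonneg fun _ => norm_nonneg _).mpr ⟨fun L =>
    (hasSum_fullTerm_of_D hk hq x hx L).summable.norm, ?_⟩
  rw [← Complex.summable_ofReal]
  convert! (hasSum_fiberSum hk hq' fun j => ((‖x j‖ : ℝ) : ℂ)).summable using 2 with L
  rw [Complex.ofReal_tsum, ← (hasSum_fullTerm_of_D hk hq' _ hx' L).tsum_eq]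
  exact tsum_congr fun η => ofReal_norm_fullTerm x q η.1

theorem hasSum_fullTerm {k : ℕ} (hk : 1 ≤ k) {q : ℂ} (hq : ‖q‖ < 1) (x : Fin k → ℂ)
    (hx : ∀ j, ‖q‖ < ‖x j‖ ∧ ‖q‖ * ‖x j‖ < 1) :
    HasSum (fun η : MarkedDurfeeSymbol k => η.fullTerm x q)
      ((if k = 1 then 1 else 0) +
        1 / qPochInf q q * ∑' n : ℕ, andrewsTerm k x q (n + 1)) := by
  have h := (summable_fullTerm hk hq x hx).hasSum
  have h' := ((Equiv.sigmaFiberEquiv fun η : MarkedDurfeeSymbol k => η.D).hasSum_iff.mpr h).sigma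
    (hasSum_fullTerm_of_D hk hq x hx)
  rwa [h'.unique (hasSum_fiberSum hk hq x)] at h

/-- Grouping the symbols by ranks and weight. -/
theorem hasSum_rankTerm {k : ℕ} {q : ℂ} {x : Fin k → ℂ} {S : ℂ}
    (h : HasSum (fun η : MarkedDurfeeSymbol k => η.fullTerm x q) S) :
    HasSum (rankTerm k x q) S := by
  refine ((Equiv.sigmaFiberEquiv fun η : MarkedDurfeeSymbol k =>
    (η.rank, η.weight)).hasSum_iff.mpr h).sigma fun p => ?_
  have hiff (η : MarkedDurfeeSymbol k) :
      (η.rank, η.weight) = p ↔ η.weight = p.2 ∧ ∀ i, η.rank i = p.1 i := by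
    rw [Prod.ext_iff, funext_iff, and_comm]
  have hfin : Finite {η : MarkedDurfeeSymbol k // (η.rank, η.weight) = p} :=
    ((finite_weight_eq k p.2).subset fun η hη => ((hiff η).mp hη).1).to_subtype
  have := Fintype.ofFinite {η : MarkedDurfeeSymbol k // (η.rank, η.weight) = p}
  have hcard : markedDurfeeCount k p.1 p.2 =
      Fintype.card {η : MarkedDurfeeSymbol k // (η.rank, η.weight) = p} := by
    rw [← Nat.card_eq_fintype_card, markedDurfeeCount]
    exact Nat.card_congr (Equiv.subtypeEquivRight fun η => (hiff η).symm)
  have hterm (η : {η : MarkedDurfeeSymbol k // (η.rank, η.weight) = p}) :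
      η.1.fullTerm x q = (∏ i, x i ^ p.1 i) * q ^ p.2 := by
    have := (hiff _).mp η.2
    simp only [fullTerm, this.1, this.2]
  have hs := hasSum_fintype
    fun η : {η : MarkedDurfeeSymbol k // (η.rank, η.weight) = p} => η.1.fullTerm x q
  rw [Finset.sum_congr rfl fun η _ => hterm η, Finset.sum_const, Finset.card_univ, ← hcard,
    nsmul_eq_mul, ← mul_assoc] at hs
  exact hs

end MarkedDurfeeSymbol

theorem theorem3p1 (k : ℕ) (hk : 1 ≤ k) (q : ℂ) (hq : ‖q‖ < 1) (x : Fin k → ℂ)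
    (hx : ∀ j, ‖q‖ < ‖x j‖ ∧ ‖q‖ * ‖x j‖ < 1) :
    Summable (rankTerm k x q) ∧
    Summable (fun n : ℕ => andrewsTerm k x q (n + 1)) ∧
    rankGenFun k x q =
      (if k = 1 then 1 else 0) +
        1 / qPochInf q q * ∑' n : ℕ, andrewsTerm k x q (n + 1) := by
  have h := MarkedDurfeeSymbol.hasSum_rankTerm (MarkedDurfeeSymbol.hasSum_fullTerm hk hq x hx)
  exact ⟨h.summable, summable_andrewsTerm hk hq x, h.tsum_eq⟩
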